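/- Let $\Omega\subset\mathbb C^m$ be a bounded domain, $\Omega^*=\{z:\bar z\in\Omega\}$, and let $\boldsymbol T=(T_1,\dots,T_m)$ be a commuting $m$-tuple of bounded operators on a separable Hilbert space $E$ in the Cowen--Douglas class $B_1(\Omega^*)$: with $D_{\boldsymbol T-w}x=((T_1-w_1)x,\dots,(T_m-w_m)x)$, for every $w\in\Omega^*$ one has $\dim\ker D_{\boldsymbol T-w}=1$ and $\operatorname{ran}D_{\boldsymbol T-w}$ is closed, and the spaces $\ker D_{\boldsymbol T-w}$, $w\in\Omega^*$, span a dense subspace of $E$. For $w\in\Omega$, the curvature matrix of $\boldsymbol T$ at $\bar w$ is $$\mathcal K_{\boldsymbol T}(\bar w)_{i,j}=-\frac{\partial^2}{\partial w_i\,\partial\bar w_j}\log\|\gamma(\bar w)\|^2,\qquad 1\le i,j\le m,$$ where $\gamma$ is any holomorphic frame, on a neighbourhood of $\bar w$ in $\Omega^*$, of the line bundle with fibres $\ker D_{\boldsymbol T-u}$ (it does not depend on the frame). Suppose that $\boldsymbol T$ is realized (up to unitary equivalence) as the adjoint $(M_1^*,\dots,M_m^*)$ of the tuple of multiplication operators by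 the coordinate functions, assumed bounded, on a reproducing kernel Hilbert space $(\mathcal H,K)\subseteq\mathrm{Hol}(\Omega_0)$ for some open subset $\Omega_0\subseteq\Omega$. Regard the Hilbert space tensor product $(\mathcal H,K)\otimes(\mathcal H,K)$ as a space of functions on $\Omega_0\times\Omega_0$, let $\mathcal A_0$ be its subspace of the functions $f$ with $f(z,z)=0$ for all $z\in\Omega_0$, and let $K_{\mathcal A_0}$ be the reproducing kernel of $\mathcal A_0$. Then for every $z\in\Omega_0$ with $K(z,z)\ne0$ the bundle has a holomorphic frame near $\bar z$, the curvature $\mathcal K_{\boldsymbol T}(\bar z)$ is well defined, and for all $1\le i,j\le m$ the following limit exists and $$\mathcal K_{\boldsymbol T}(\bar z)_{i,j}=-\frac{2}{K(z,z)^2}\lim_{\substack{\zeta_i\to z_i\\ \nu_j\to z_j}}\frac{K_{\mathcal A_0}(z,\zeta;z,\nu)}{(z_i-\zeta_i)(\bar z_j-\bar\nu_j)},$$ where $\zeta,\nu\in\Omega_0$ satisfy $\zeta_l=z_l$ for $l\ne i$, $\nu_l=z_l$ for $l\ne j$, $\zeta_i\ne z_i$ and $\nu_j\ne z_j$. In particular,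 for $i=j$ one may take $\nu=\zeta$: $$\mathcal K_{\boldsymbol T}(\bar z)_{i,i}=-\frac{2}{K(z,z)^2}\lim_{\zeta_i\to z_i}\frac{K_{\mathcal A_0}(z,\zeta;z,\zeta)}{|z_i-\zeta_i|^2}\Big|_{\zeta_l=z_l,\ l\ne i}.$$ -/

import Mathlib

open Filter Topology
open scoped TensorProduct ComplexConjugate

noncomputable section

namespace CowenDouglasCurvature

/-! ### The Cowen–Douglas class and its curvature -/

section CowenDouglas

variable {m : ℕ} {E : Type*} [NormedAddCommGroup E] [InnerProductSpace ℂ E]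

/-- `D_{T - w} : E → E ⊕ ⋯ ⊕ E`, `x ↦ ((T₁ - w₁) x, …, (T_m - w_m) x)`. -/
def tupleSub (T : Fin m → E →L[ℂ] E) (w : Fin m → ℂ) : E →L[ℂ] (Fin m → E) :=
  ContinuousLinearMap.pi fun i => T i - w i • ContinuousLinearMap.id ℂ E

/-- The joint eigenspace `ker D_{T - w}`. -/
def jointKer (T : Fin m → E →L[ℂ] E) (w : Fin m → ℂ) : Submodule ℂ E :=
  LinearMap.ker (tupleSub T w).toLinearMap

/-- The commuting tuple `T` belongs to the Cowen–Douglas class `B_n(Ω)`. -/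
structure IsCowenDouglas (n : ℕ) (Ω : Set (Fin m → ℂ)) (T : Fin m → E →L[ℂ] E) : Prop where
  commute : ∀ i j, Commute (T i) (T j)
  rank_ker : ∀ w ∈ Ω, Module.rank ℂ (jointKer T w) = n
  isClosed_range : ∀ w ∈ Ω, IsClosed (Set.range (tupleSub T w))
  dense_span : (⨆ w ∈ Ω, jointKer T w).topologicalClosure = ⊤

/-- `Ω^* = {z : z̄ ∈ Ω}`. -/
def conjSet (Ω : Set (Fin m → ℂ)) : Set (Fin m → ℂ) := {z | star z ∈ Ω}

/-- `γ` is a holomorphic frame, over the open set `U`, of the line bundle with fibre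
`ker D_{T - u}` at `u`. -/
structure IsHolomorphicFrame (T : Fin m → E →L[ℂ] E) (U : Set (Fin m → ℂ))
    (γ : (Fin m → ℂ) → E) : Prop where
  isOpen : IsOpen U
  differentiableOn : DifferentiableOn ℂ γ U
  ne_zero : ∀ u ∈ U, γ u ≠ 0
  span_eq : ∀ u ∈ U, Submodule.span ℂ {γ u} = jointKer T u

/-- The Wirtinger derivative `∂/∂w_i`. -/
def wirtinger (i : Fin m) (f : (Fin m → ℂ) → ℂ) (w : Fin m → ℂ) : ℂ :=
  (fderiv ℝ f w (Pi.single i 1) - Complex.I * fderiv ℝ f w (Pi.single i Complex.I)) / 2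

/-- The Wirtinger derivative `∂/∂w̄_j`. -/
def wirtingerBar (j : Fin m) (f : (Fin m → ℂ) → ℂ) (w : Fin m → ℂ) : ℂ :=
  (fderiv ℝ f w (Pi.single j 1) + Complex.I * fderiv ℝ f w (Pi.single j Complex.I)) / 2

/-- The matrix `-(∂_i ∂̄_j log ‖γ(w̄)‖²)` at the point `w`; the derivatives are taken in the
variable `w`. -/
def frameCurvature (γ : (Fin m → ℂ) → E) (w : Fin m → ℂ) : Matrix (Fin m) (Fin m) ℂ :=
  Matrix.of fun i j =>
    -wirtinger i (wirtingerBar j fun v => ((Real.log (‖γ (star v)‖ ^ 2) : ℝ) : ℂ)) w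

/-- `𝒦` is the curvature matrix `𝒦_T(w̄)` of the tuple `T ∈ B₁(Ω^*)` at `w̄ ∈ Ω^*`: the bundle has
a holomorphic frame near `w̄`, and every such frame computes `𝒦`. -/
def IsCurvatureAt (Ω : Set (Fin m → ℂ)) (T : Fin m → E →L[ℂ] E) (w : Fin m → ℂ)
    (𝒦 : Matrix (Fin m) (Fin m) ℂ) : Prop :=
  (∃ U γ, U ⊆ conjSet Ω ∧ star w ∈ U ∧ IsHolomorphicFrame T U γ) ∧
    ∀ U γ, U ⊆ conjSet Ω → star w ∈ U → IsHolomorphicFrame T U γ → 𝒦 = frameCurvature γ w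

end CowenDouglas

/-! ### Reproducing kernel Hilbert spaces and their tensor products -/

section Kernel

/-- The reproducing kernel of a Hilbert space of scalar functions, as a scalar function
`K(x, y) = K(·, y)(x)`. -/
def scalarKernel {X : Type*} (H : Type*) [NormedAddCommGroup H] [InnerProductSpace ℂ H]
    [RKHS ℂ H X ℂ] [CompleteSpace H] (x y : X) : ℂ :=
  RKHS.kernel H x y 1

variable {X Y : Type*} (H G : Type*)
  [NormedAddCommGroup H] [InnerProductSpace ℂ H] [RKHS ℂ H X ℂ] [CompleteSpace H]
  [NormedAddCommGroup G] [InnerProductSpace ℂ G] [RKHS ℂ G Y ℂ] [CompleteSpace G]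

/-- The Hilbert space tensor product: the completion of the algebraic tensor product. -/
abbrev HilbertTensor (H G : Type*) [NormedAddCommGroup H] [InnerProductSpace ℂ H]
    [NormedAddCommGroup G] [InnerProductSpace ℂ G] : Type _ :=
  UniformSpace.Completion (H ⊗[ℂ] G)

/-- The vector `K_H(·, x) ⊗ K_G(·, y)`. -/
def tensorKerFun (p : X × Y) : HilbertTensor H G :=
  ((RKHS.kerFun H p.1 (1 : ℂ) ⊗ₜ[ℂ] RKHS.kerFun G p.2 (1 : ℂ) : H ⊗[ℂ] G) : HilbertTensor H G)

/-- Evaluation of elements of the tensor product at the points of `X × Y`; it is the continuous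
extension of `(f ⊗ g)(x, y) = f x * g y`. -/
def tensorEval : HilbertTensor H G →L[ℂ] (X × Y → ℂ) :=
  ContinuousLinearMap.pi fun p => innerSL ℂ (tensorKerFun H G p)

theorem tensorEval_tmul (f : H) (g : G) (x : X) (y : Y) :
    tensorEval H G ((f ⊗ₜ[ℂ] g : H ⊗[ℂ] G) : HilbertTensor H G) (x, y) = f x * g y := by
  simp [tensorEval, tensorKerFun]

/-- A continuous functional that kills all kernel functions is zero. -/
theorem clm_eq_zero_of_kerFun (φ : H →L[ℂ] ℂ) (h : ∀ x : X, φ (RKHS.kerFun H x (1 : ℂ)) = 0) :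
    φ = 0 := by
  have hle : Submodule.span ℂ {RKHS.kerFun H x v | (x : X) (v : ℂ)} ≤
      LinearMap.ker φ.toLinearMap := by
    rw [Submodule.span_le]
    rintro _ ⟨x, v, rfl⟩
    have hv : RKHS.kerFun H x v = v • RKHS.kerFun H x (1 : ℂ) := by
      rw [← map_smul]; simp
    simp [hv, h x]
  have htop := Submodule.topologicalClosure_minimal _ hle φ.isClosed_ker
  rw [RKHS.kerFun_dense] at htop
  ext f
  exact htop (Submodule.mem_top (x := f))

theorem tensorEval_injective :
    Function.Injective (tensorEval H G : HilbertTensor H G → X × Y → ℂ) := by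
  refine (injective_iff_map_eq_zero _).mpr fun f hf => ?_
  let B : H →L[ℂ] G →L[ℂ] ℂ :=
    (ContinuousLinearMap.compL ℂ G (H ⊗[ℂ] G) ℂ
      ((innerSL ℂ f).comp UniformSpace.Completion.toComplL)).comp (TensorProduct.mkL ℂ H G)
  have hB : ∀ h g, B h g = inner ℂ f ((h ⊗ₜ[ℂ] g : H ⊗[ℂ] G) : HilbertTensor H G) :=
    fun h g => rfl
  have key : ∀ (x : X) (y : Y), B (RKHS.kerFun H x (1 : ℂ)) (RKHS.kerFun G y (1 : ℂ)) = 0 := by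
    intro x y
    rw [hB, inner_eq_zero_symm]
    exact congrFun hf (x, y)
  have h1 : ∀ x : X, B (RKHS.kerFun H x (1 : ℂ)) = 0 := fun x =>
    clm_eq_zero_of_kerFun G _ (key x)
  have h2 : ∀ h g, B h g = 0 := fun h g => by
    have := clm_eq_zero_of_kerFun H (B.flip g) (fun x => by simp [h1 x])
    simpa using congrArg (fun ψ => ψ h) this
  have h3 : ∀ t : H ⊗[ℂ] G, inner ℂ f (t : HilbertTensor H G) = 0 := by
    intro t
    induction t using TensorProduct.induction_on with
    | zero => rw [UniformSpace.Completion.coe_zero, inner_zero_right]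
    | tmul h g => rw [← hB]; exact h2 h g
    | add a b ha hb => rw [UniformSpace.Completion.coe_add, inner_add_right, ha, hb, add_zero]
  exact UniformSpace.Completion.denseRange_coe.eq_zero_of_inner_left ℂ h3

/-- `(H, K_H) ⊗ (G, K_G)` as a Hilbert space of functions on `X × Y`. -/
instance instRKHSHilbertTensor : RKHS ℂ (HilbertTensor H G) (X × Y) ℂ where
  coeCLM := tensorEval H G
  coeCLM_injective := tensorEval_injective H G

/-- The subspace `𝒜₀` of the functions in `(H, K) ⊗ (H, K)` that vanish on the diagonal. -/
def diagVanishing : Submodule ℂ (HilbertTensor H H) where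
  carrier := {f | ∀ x : X, f (x, x) = 0}
  add_mem' hf hg x := by simp [hf x, hg x]
  zero_mem' x := by simp
  smul_mem' c f hf x := by simp [hf x]

theorem isClosed_diagVanishing : IsClosed (diagVanishing H : Set (HilbertTensor H H)) := by
  have : (diagVanishing H : Set (HilbertTensor H H)) =
      ⋂ x : X, {f : HilbertTensor H H | f (x, x) = 0} := by
    ext f; simp [diagVanishing]
  rw [this]
  exact isClosed_iInter fun x => isClosed_eq (RKHS.continuous_eval (x, x)) continuous_const

instance instCompleteSpaceDiagVanishing : CompleteSpace (diagVanishing H) :=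
  (isClosed_diagVanishing H).completeSpace_coe

/-- `𝒜₀`, with the norm of the tensor product, as a Hilbert space of functions on `X × X`. -/
instance instRKHSDiagVanishing : RKHS ℂ (diagVanishing H) (X × X) ℂ where
  coeCLM := (RKHS.coeCLM ℂ).comp (diagVanishing H).subtypeL
  coeCLM_injective := fun _ _ h => Subtype.ext (RKHS.coeCLM_injective h)

end Kernel

/-! ### Multiplication by the coordinate functions -/

section Multiplication

variable {m : ℕ} {Ω₀ : Set (Fin m → ℂ)} {H : Type*}
  [NormedAddCommGroup H] [InnerProductSpace ℂ H] [RKHS ℂ H Ω₀ ℂ]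

/-- All functions in `H` are holomorphic on `Ω₀`, that is `H ⊆ Hol(Ω₀)`. -/
def ConsistsOfHolomorphic (Ω₀ : Set (Fin m → ℂ)) (H : Type*)
    [NormedAddCommGroup H] [InnerProductSpace ℂ H] [RKHS ℂ H Ω₀ ℂ] : Prop :=
  ∀ f : H, DifferentiableOn ℂ (Function.extend Subtype.val (f : Ω₀ → ℂ) 0) Ω₀

/-- `M` is the tuple of multiplication operators by the coordinate functions. -/
def IsCoordinateMultiplication (M : Fin m → H →L[ℂ] H) : Prop :=
  ∀ (i : Fin m) (f : H) (z : Ω₀), M i f z = (z : Fin m → ℂ) i * f z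

end Multiplication

end CowenDouglasCurvature

end

open CowenDouglasCurvature

/-!
Over `Ω₀^*` the bundle is framed by the kernel functions `γ(u) = K(·, ū)`. The curvature of a frame
is `-⟪γ ∧ ∂ᵢγ, γ ∧ ∂ⱼγ⟫ / ‖γ‖⁴`, and since multiplying `γ` by a holomorphic function `c` multiplies
`γ ∧ ∂ᵢγ` by `c²`, it does not depend on the frame.

The kernel vector of `𝒜₀` at `(z, ζ)` is the projection of `K_z ⊗ K_ζ`, which vanishes at `ζ = z`;
to first order in `ζ - z` it is therefore the projection of `K_z ⊗ ∂̄ᵢK_z`. Every `γ ⊗ γ` is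
orthogonal to `𝒜₀`, hence so is its derivative `γ ⊗ ∂ᵢγ + ∂ᵢγ ⊗ γ`, whereas antisymmetric tensors
lie in `𝒜₀`. The projection is thus `(K_z ⊗ ∂̄ᵢK_z - ∂̄ᵢK_z ⊗ K_z) / 2`, and the inner product of
two such vectors is half of `⟪K_z ∧ ∂̄ᵢK_z, K_z ∧ ∂̄ⱼK_z⟫`.
-/

namespace CowenDouglasCurvature

section Holomorphic

open Metric

variable {X Y G : Type*} [NormedAddCommGroup X] [NormedSpace ℂ X]
  [NormedAddCommGroup Y] [NormedSpace ℂ Y] [NormedAddCommGroup G] [NormedSpace ℂ G]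

theorem norm_fderiv_le_of_norm_le {F : X → G} {c : X} {R C : ℝ}
    (hd : DifferentiableOn ℂ F (ball c R)) (hC : ∀ x ∈ ball c R, ‖F x‖ ≤ C) (hR : 0 < R) :
    ‖fderiv ℂ F c‖ ≤ 2 * C / R := by
  refine Complex.norm_fderiv_le_div_of_mapsTo_ball hd (fun x hx => ?_) hR
  rw [mem_closedBall, dist_eq_norm]
  linarith [norm_sub_le (F x) (F c), hC x hx, hC c (mem_ball_self hR)]

theorem norm_sub_sub_fderiv_le_of_norm_le {F : X → G} {c w : X} {R C : ℝ}
    (hd : DifferentiableOn ℂ F (ball c R)) (hC : ∀ x ∈ ball c R, ‖F x‖ ≤ C)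
    (hw : w ∈ ball c R) :
    ‖F w - F c - fderiv ℂ F c (w - c)‖ ≤ 4 * C * (‖w - c‖ / R) ^ 2 := by
  have hR : 0 < R := nonempty_ball.mp ⟨w, hw⟩
  have hFc : ‖F c‖ ≤ C := hC c (mem_ball_self hR)
  set r : X → G := fun x => F x - F c - fderiv ℂ F c (x - c) with hr
  have hrc : r c = 0 := by simp [hr]
  have hrd : DifferentiableOn ℂ r (ball c R) :=
    (hd.sub_const _).sub (by fun_prop)
  have hmaps : Set.MapsTo r (ball c R) (closedBall (r c) (4 * C)) := fun x hx => by
    have hlin : ‖fderiv ℂ F c (x - c)‖ ≤ 2 * C / R * R :=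
      (fderiv ℂ F c).le_of_opNorm_le_of_le (norm_fderiv_le_of_norm_le hd hC hR)
        (mem_ball_iff_norm.mp hx).le
    rw [div_mul_cancel₀ _ hR.ne'] at hlin
    rw [hrc, mem_closedBall_zero_iff]
    linarith [norm_sub_le (F x - F c) (fderiv ℂ F c (x - c)), norm_sub_le (F x) (F c), hC x hx]
  have hlittle : (r · - r c) =o[𝓝 c] fun x => ‖x - c‖ ^ 1 := by
    simp only [hrc, sub_zero, pow_one]
    exact (hd.differentiableAt (ball_mem_nhds _ hR)).hasFDerivAt.isLittleO.norm_right
  simpa [hrc, dist_eq_norm, hr] using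
    Complex.dist_le_mul_div_pow_of_mapsTo_ball_of_isLittleO hrd hmaps hlittle hw

theorem uniformCauchySeqOn_fderiv {ι : Type*} {l : Filter ι} {f : ι → X → G} {c : X} {R : ℝ}
    (hR : 0 < R) (hf : UniformCauchySeqOn f l (ball c (R + R)))
    (hd : ∀ᶠ n in l, DifferentiableOn ℂ (f n) (ball c (R + R))) :
    UniformCauchySeqOn (fun n => fderiv ℂ (f n)) l (ball c R) := by
  intro s hs
  obtain ⟨ε, hε, hεs⟩ := mem_uniformity_dist.mp hs
  have hδ : 0 < ε * R / 4 := by positivity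
  filter_upwards [hf _ (dist_mem_uniformity hδ), hd.prod_mk hd] with p hp hdp y hy
  have hsub : ball y R ⊆ ball c (R + R) := ball_subset_ball' (by linarith [mem_ball.mp hy])
  have hnhds : ball c (R + R) ∈ 𝓝 y := isOpen_ball.mem_nhds (hsub (mem_ball_self hR))
  have hbound : ∀ u ∈ ball y R, ‖(f p.1 - f p.2) u‖ ≤ ε * R / 4 := fun u hu =>
    (dist_eq_norm _ _).symm.trans_le (hp u (hsub hu)).le
  refine hεs ?_
  rw [dist_eq_norm, ← fderiv_sub (hdp.1.differentiableAt hnhds) (hdp.2.differentiableAt hnhds)]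
  calc ‖fderiv ℂ (f p.1 - f p.2) y‖ ≤ 2 * (ε * R / 4) / R :=
        norm_fderiv_le_of_norm_le ((hdp.1.sub hdp.2).mono hsub) hbound hR
    _ = ε / 2 := by field_simp; norm_num
    _ < ε := half_lt_self hε

theorem differentiableAt_of_tendstoUniformlyOn [CompleteSpace G] {ι : Type*} {l : Filter ι}
    [l.NeBot] {f : ι → X → G} {g : X → G} {c : X} {s : Set X} (hs : s ∈ 𝓝 c)
    (hf : TendstoUniformlyOn f g l s) (hd : ∀ᶠ n in l, DifferentiableOn ℂ (f n) s) :
    DifferentiableAt ℂ g c := by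
  obtain ⟨ε, hε, hεs⟩ := Metric.mem_nhds_iff.mp hs
  have hR : 0 < ε / 2 := half_pos hε
  rw [← add_halves ε] at hεs
  have hcauchy : UniformCauchySeqOn (fun n => fderiv ℂ (f n)) l (ball c (ε / 2)) :=
    uniformCauchySeqOn_fderiv hR (hf.mono hεs).uniformCauchySeqOn
      (hd.mono fun _ h => h.mono hεs)
  have hlim : TendstoUniformlyOn (fun n => fderiv ℂ (f n))
      (fun y => lim (map (fun n => fderiv ℂ (f n) y) l)) l (ball c (ε / 2)) :=
    hcauchy.tendstoUniformlyOn_of_tendsto fun y hy => (hcauchy.cauchy_map hy).le_nhds_lim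
  have hball : ball c (ε / 2) ∈ 𝓝 c := ball_mem_nhds c hR
  refine (hasFDerivAt_of_tendstoUniformlyOnFilter
    (hlim.tendstoUniformlyOnFilter.mono_right (le_principal_iff.mpr hball)) ?_
    (eventually_of_mem hs fun y hy => hf.tendsto_at hy)).differentiableAt
  filter_upwards [hd.prod_mk (eventually_mem_nhds_iff.mpr hs)] with p hp
  exact (hp.1.differentiableAt hp.2).hasFDerivAt

theorem norm_slope_sub_fderiv_le {F : X → G} {y v : X} {R C : ℝ} {t : ℂ}
    (hd : DifferentiableOn ℂ F (ball y R)) (hC : ∀ x ∈ ball y R, ‖F x‖ ≤ C)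
    (ht : t ≠ 0) (htv : ‖t • v‖ < R) :
    ‖t⁻¹ • (F (y + t • v) - F y) - fderiv ℂ F y v‖ ≤ 4 * C * (‖v‖ / R) ^ 2 * ‖t‖ := by
  have hremainder : t⁻¹ • (F (y + t • v) - F y) - fderiv ℂ F y v =
      t⁻¹ • (F (y + t • v) - F y - fderiv ℂ F y (y + t • v - y)) := by
    simp [smul_sub, smul_smul, ht]
  rw [hremainder, norm_smul, norm_inv, inv_mul_le_iff₀ (norm_pos_iff.mpr ht)]
  refine (norm_sub_sub_fderiv_le_of_norm_le hd hC (by simpa using htv)).trans_eq ?_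
  rw [add_sub_cancel_left, norm_smul]
  ring

theorem eventually_ne_zero_and_norm_smul_lt (v : X) {R : ℝ} (hR : 0 < R) :
    ∀ᶠ t : ℂ in 𝓝[≠] 0, t ≠ 0 ∧ ‖t • v‖ < R := by
  refine eventually_mem_nhdsWithin.and (eventually_nhdsWithin_of_eventually_nhds ?_)
  have hcont : Continuous fun t : ℂ => ‖t • v‖ := by fun_prop
  exact (hcont.tendsto 0).eventually_lt_const (by simpa using hR)

theorem tendstoUniformlyOn_slope {F : X → G} {x : X} {R C : ℝ} (hR : 0 < R)
    (hd : DifferentiableOn ℂ F (ball x (R + R))) (hC : ∀ y ∈ ball x (R + R), ‖F y‖ ≤ C) (v : X) :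
    TendstoUniformlyOn (fun (t : ℂ) y => t⁻¹ • (F (y + t • v) - F y))
      (fun y => fderiv ℂ F y v) (𝓝[≠] 0) (ball x R) := by
  have hlim : Tendsto (fun t : ℂ => 4 * C * (‖v‖ / R) ^ 2 * ‖t‖) (𝓝[≠] 0) (𝓝 0) := by
    have hcont : Continuous fun t : ℂ => 4 * C * (‖v‖ / R) ^ 2 * ‖t‖ := by fun_prop
    simpa using (hcont.tendsto 0).mono_left (nhdsWithin_le_nhds (s := {0}ᶜ))
  refine Metric.tendstoUniformlyOn_iff.mpr fun ε hε => ?_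
  filter_upwards [eventually_ne_zero_and_norm_smul_lt v hR, hlim.eventually_lt_const hε]
    with t ⟨ht, htv⟩ htε y hy
  have hsub : ball y R ⊆ ball x (R + R) := ball_subset_ball' (by linarith [mem_ball.mp hy])
  rw [dist_comm, dist_eq_norm]
  exact (norm_slope_sub_fderiv_le (hd.mono hsub) (fun u hu => hC u (hsub hu)) ht htv).trans_lt htε

theorem exists_ball_differentiableOn_norm_le {F : X → G} {x : X}
    (hF : ∀ᶠ u in 𝓝 x, DifferentiableAt ℂ F u) :
    ∃ R > 0, ∃ C, DifferentiableOn ℂ F (ball x (R + R)) ∧ ∀ y ∈ ball x (R + R), ‖F y‖ ≤ C := by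
  have hbound : ∀ᶠ y in 𝓝 x, ‖F y‖ < ‖F x‖ + 1 :=
    hF.self_of_nhds.continuousAt.norm.eventually_lt_const (lt_add_one _)
  obtain ⟨ε, hε, hball⟩ := Metric.eventually_nhds_iff_ball.mp (hF.and hbound)
  refine ⟨ε / 2, half_pos hε, ‖F x‖ + 1, ?_, ?_⟩ <;> rw [add_halves]
  · exact fun y hy => (hball y hy).1.differentiableWithinAt
  · exact fun y hy => (hball y hy).2.le

theorem differentiableAt_fderiv_apply [CompleteSpace G] {F : X → G} {x : X}
    (hF : ∀ᶠ u in 𝓝 x, DifferentiableAt ℂ F u) (v : X) :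
    DifferentiableAt ℂ (fun u => fderiv ℂ F u v) x := by
  obtain ⟨R, hR, C, hd, hC⟩ := exists_ball_differentiableOn_norm_le hF
  refine differentiableAt_of_tendstoUniformlyOn (ball_mem_nhds x hR)
    (tendstoUniformlyOn_slope hR hd hC v) ?_
  filter_upwards [eventually_ne_zero_and_norm_smul_lt v hR] with t ⟨_, htv⟩
  have hshift : Set.MapsTo (fun y => y + t • v) (ball x R) (ball x (R + R)) := fun y hy => by
    rw [mem_ball, dist_eq_norm] at hy ⊢
    rw [add_sub_right_comm]
    exact (norm_add_le _ _).trans_lt (add_lt_add hy htv)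
  exact ((hd.comp (by fun_prop) hshift).sub
    (hd.mono (ball_subset_ball (by linarith)))).const_smul _

theorem exists_norm_le_of_continuousOn_apply {Z : Type*} [TopologicalSpace Z] [CompleteSpace Y]
    {Φ : Z → Y →L[ℂ] G} {K : Set Z} (hK : IsCompact K)
    (hΦ : ∀ y, ContinuousOn (fun x => Φ x y) K) :
    ∃ C, ∀ x ∈ K, ‖Φ x‖ ≤ C := by
  obtain ⟨C, hC⟩ := banach_steinhaus (g := fun x : K => Φ x) fun y =>
    (hK.exists_bound_of_continuousOn (hΦ y)).imp fun _ h x => h x x.2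
  exact ⟨C, fun x hx => hC ⟨x, hx⟩⟩

theorem exists_clm_forall_apply_eq_fderiv {Φ : X → Y →L[ℂ] G} {c : X} {R C : ℝ} (hR : 0 < R)
    (hd : ∀ y, DifferentiableOn ℂ (fun x => Φ x y) (ball c R))
    (hC : ∀ x ∈ ball c R, ‖Φ x‖ ≤ C) :
    ∃ Λ : X →L[ℂ] Y →L[ℂ] G, ∀ v y, Λ v y = fderiv ℂ (fun x => Φ x y) c v := by
  have hdc : ∀ y, DifferentiableAt ℂ (fun x => Φ x y) c := fun y =>
    (hd y).differentiableAt (ball_mem_nhds c hR)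
  let D : Y →ₗ[ℂ] X →L[ℂ] G :=
    { toFun := fun y => fderiv ℂ (fun x => Φ x y) c
      map_add' := fun y₁ y₂ => by
        simp only [map_add]
        exact fderiv_fun_add (hdc y₁) (hdc y₂)
      map_smul' := fun a y => by
        simp only [map_smul]
        exact fderiv_fun_const_smul (hdc y) a }
  have hD : ∀ y, ‖D y‖ ≤ 2 * C / R * ‖y‖ := fun y => by
    refine (norm_fderiv_le_of_norm_le (C := C * ‖y‖) (hd y)
      (fun x hx => (Φ x).le_of_opNorm_le (hC x hx) y) hR).trans_eq ?_
    ring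
  exact ⟨(D.mkContinuous _ hD).flip, fun v y => rfl⟩

theorem differentiableAt_clm_of_differentiableOn_apply {Φ : X → Y →L[ℂ] G} {c : X} {R C : ℝ}
    (hR : 0 < R) (hd : ∀ y, DifferentiableOn ℂ (fun x => Φ x y) (ball c R))
    (hC : ∀ x ∈ ball c R, ‖Φ x‖ ≤ C) : DifferentiableAt ℂ Φ c := by
  obtain ⟨Λ, hΛ⟩ := exists_clm_forall_apply_eq_fderiv hR hd hC
  have hC₀ : 0 ≤ C := (norm_nonneg _).trans (hC c (mem_ball_self hR))
  -- The remainder of `Φ · y` is bounded by a constant proportional to `‖y‖`, so the pointwise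
  -- estimates amount to one in operator norm.
  have hremainder : ∀ w ∈ ball c R,
      ‖Φ w - Φ c - Λ (w - c)‖ ≤ 4 * C / R ^ 2 * ‖‖w - c‖ ^ 2‖ := fun w hw => by
    refine ContinuousLinearMap.opNorm_le_bound _ (by positivity) fun y => ?_
    have hy := norm_sub_sub_fderiv_le_of_norm_le (C := C * ‖y‖) (hd y)
      (fun x hx => (Φ x).le_of_opNorm_le (hC x hx) y) hw
    rw [← hΛ] at hy
    refine hy.trans_eq ?_
    rw [norm_pow, norm_norm]
    ring
  have hsq : (fun w => ‖w - c‖ ^ 2) =o[𝓝 c] fun w => w - c :=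
    (Asymptotics.isLittleO_norm_pow_id one_lt_two).comp_tendsto
      (tendsto_sub_nhds_zero_iff.mpr tendsto_id)
  exact (HasFDerivAt.of_isLittleO ((Asymptotics.IsBigO.of_bound _
    (eventually_of_mem (ball_mem_nhds c hR) hremainder)).trans_isLittleO hsq)).differentiableAt

theorem differentiableOn_clm_of_apply [ProperSpace X] [CompleteSpace Y] {Φ : X → Y →L[ℂ] G}
    {U : Set X} (hU : IsOpen U) (hΦ : ∀ y, DifferentiableOn ℂ (fun x => Φ x y) U) :
    DifferentiableOn ℂ Φ U := by
  intro c hc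
  obtain ⟨R, hR, hRU⟩ := nhds_basis_closedBall.mem_iff.mp (hU.mem_nhds hc)
  obtain ⟨C, hC⟩ := exists_norm_le_of_continuousOn_apply (isCompact_closedBall c R) fun y =>
    (hΦ y).continuousOn.mono hRU
  exact (differentiableAt_clm_of_differentiableOn_apply hR
    (fun y => (hΦ y).mono (ball_subset_closedBall.trans hRU))
    fun x hx => hC x (ball_subset_closedBall hx)).differentiableWithinAt

end Holomorphic

section Wirtinger

variable {m : ℕ} {E : Type*} [NormedAddCommGroup E]

theorem star_single_I (i : Fin m) :
    star (Pi.single i Complex.I : Fin m → ℂ) = -Complex.I • Pi.single i (1 : ℂ) := by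
  rw [Pi.star_single, ← Pi.single_smul]
  simp

theorem hasFDerivAt_comp_star [NormedSpace ℂ E] {γ : (Fin m → ℂ) → E} {w : Fin m → ℂ}
    (hγ : DifferentiableAt ℂ γ (star w)) :
    HasFDerivAt (fun v => γ (star v))
      (((fderiv ℂ γ (star w)).restrictScalars ℝ).comp
        (starL' ℝ : (Fin m → ℂ) ≃L[ℝ] (Fin m → ℂ)).toContinuousLinearMap) w :=
  (hγ.hasFDerivAt.restrictScalars ℝ).comp w
    (starL' ℝ : (Fin m → ℂ) ≃L[ℝ] (Fin m → ℂ)).hasFDerivAt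

variable [InnerProductSpace ℂ E] {α β : (Fin m → ℂ) → E} {w : Fin m → ℂ}

theorem differentiableAt_inner_comp_star (hα : DifferentiableAt ℂ α (star w))
    (hβ : DifferentiableAt ℂ β (star w)) :
    DifferentiableAt ℝ (fun v => inner ℂ (α (star v)) (β (star v))) w :=
  (hasFDerivAt_comp_star hα).differentiableAt.inner ℂ (hasFDerivAt_comp_star hβ).differentiableAt

theorem fderiv_inner_comp_star (hα : DifferentiableAt ℂ α (star w))
    (hβ : DifferentiableAt ℂ β (star w)) (v : Fin m → ℂ) :
    fderiv ℝ (fun v => inner ℂ (α (star v)) (β (star v))) w v =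
      inner ℂ (α (star w)) (fderiv ℂ β (star w) (star v)) +
        inner ℂ (fderiv ℂ α (star w) (star v)) (β (star w)) := by
  rw [((hasFDerivAt_comp_star hα).inner ℂ (hasFDerivAt_comp_star hβ)).fderiv]
  rfl

theorem wirtinger_inner_comp_star (hα : DifferentiableAt ℂ α (star w))
    (hβ : DifferentiableAt ℂ β (star w)) (i : Fin m) :
    wirtinger i (fun v => inner ℂ (α (star v)) (β (star v))) w =
      inner ℂ (fderiv ℂ α (star w) (Pi.single i 1)) (β (star w)) := by
  rw [wirtinger, fderiv_inner_comp_star hα hβ, fderiv_inner_comp_star hα hβ, star_single_I,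
    Pi.star_single, star_one]
  simp only [map_smul, inner_smul_left, inner_smul_right, map_neg, Complex.conj_I]
  linear_combination (-inner ℂ (fderiv ℂ α (star w) (Pi.single i 1)) (β (star w)) / 2 +
    inner ℂ (α (star w)) (fderiv ℂ β (star w) (Pi.single i 1)) / 2) * Complex.I_mul_I

theorem wirtingerBar_inner_comp_star (hα : DifferentiableAt ℂ α (star w))
    (hβ : DifferentiableAt ℂ β (star w)) (j : Fin m) :
    wirtingerBar j (fun v => inner ℂ (α (star v)) (β (star v))) w =
      inner ℂ (α (star w)) (fderiv ℂ β (star w) (Pi.single j 1)) := by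
  rw [wirtingerBar, fderiv_inner_comp_star hα hβ, fderiv_inner_comp_star hα hβ, star_single_I,
    Pi.star_single, star_one]
  simp only [map_smul, inner_smul_left, inner_smul_right, map_neg, Complex.conj_I]
  linear_combination (inner ℂ (fderiv ℂ α (star w) (Pi.single j 1)) (β (star w)) / 2 -
    inner ℂ (α (star w)) (fderiv ℂ β (star w) (Pi.single j 1)) / 2) * Complex.I_mul_I

theorem wirtingerBar_comp {φ : ℂ → ℂ} {φ' : ℂ} {f : (Fin m → ℂ) → ℂ}
    (hφ : HasDerivAt φ φ' (f w)) (hf : DifferentiableAt ℝ f w) (j : Fin m) :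
    wirtingerBar j (fun v => φ (f v)) w = φ' * wirtingerBar j f w := by
  have hcomp : HasFDerivAt (fun v => φ (f v)) _ w :=
    (hφ.hasFDerivAt.restrictScalars ℝ).comp w hf.hasFDerivAt
  simp only [wirtingerBar, hcomp.fderiv, ContinuousLinearMap.comp_apply,
    ContinuousLinearMap.coe_restrictScalars', ContinuousLinearMap.toSpanSingleton_apply,
    smul_eq_mul]
  ring

theorem wirtinger_div {p q : (Fin m → ℂ) → ℂ} (hp : DifferentiableAt ℝ p w)
    (hq : DifferentiableAt ℝ q w) (hq₀ : q w ≠ 0) (i : Fin m) :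
    wirtinger i (fun v => p v / q v) w =
      (q w * wirtinger i p w - p w * wirtinger i q w) / q w ^ 2 := by
  have hinv : HasFDerivAt (fun v => (q v)⁻¹) _ w :=
    ((hasDerivAt_inv hq₀).hasFDerivAt.restrictScalars ℝ).comp w hq.hasFDerivAt
  have hdiv := hp.hasFDerivAt.fun_mul hinv
  simp only [← div_eq_mul_inv] at hdiv
  simp only [wirtinger, hdiv.fderiv, add_apply, smul_apply,
    ContinuousLinearMap.comp_apply, ContinuousLinearMap.coe_restrictScalars',
    ContinuousLinearMap.toSpanSingleton_apply, smul_eq_mul]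
  field_simp
  ring

theorem wirtinger_congr {f g : (Fin m → ℂ) → ℂ} (h : f =ᶠ[𝓝 w] g) (i : Fin m) :
    wirtinger i f w = wirtinger i g w := by
  rw [wirtinger, wirtinger, h.fderiv_eq]

end Wirtinger

section Curvature

variable {m : ℕ} {E : Type*} [NormedAddCommGroup E] [InnerProductSpace ℂ E]

/-- The inner product `⟪a ∧ b, a ∧ c⟫` of two bivectors with a common factor, written as a Gram
determinant so that no exterior power is needed. -/
noncomputable def innerWedge (a b c : E) : ℂ :=
  inner ℂ a a * inner ℂ b c - inner ℂ a c * inner ℂ b a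

theorem innerWedge_smul_smul_add_smul (a b c : E) (s t r : ℂ) :
    innerWedge (s • a) (s • b + t • a) (s • c + r • a) = (conj s * s) ^ 2 * innerWedge a b c := by
  simp only [innerWedge, inner_add_left, inner_add_right, inner_smul_left, inner_smul_right]
  ring

theorem ofReal_log_norm_sq (x : E) :
    ((Real.log (‖x‖ ^ 2) : ℝ) : ℂ) = Complex.log (inner ℂ x x) := by
  rw [inner_self_eq_norm_sq_to_K, Complex.ofReal_log (by positivity)]
  simp

theorem inner_self_mem_slitPlane {x : E} (hx : x ≠ 0) : inner ℂ x x ∈ Complex.slitPlane := by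
  have hpos : 0 < ‖x‖ ^ 2 := by positivity
  rw [inner_self_eq_norm_sq_to_K]
  exact_mod_cast Complex.ofReal_mem_slitPlane.mpr hpos

variable {γ γ₁ γ₂ : (Fin m → ℂ) → E} {w : Fin m → ℂ}

theorem wirtingerBar_log_norm_sq_comp_star (hγ : DifferentiableAt ℂ γ (star w))
    (hne : γ (star w) ≠ 0) (j : Fin m) :
    wirtingerBar j (fun v => ((Real.log (‖γ (star v)‖ ^ 2) : ℝ) : ℂ)) w =
      inner ℂ (γ (star w)) (fderiv ℂ γ (star w) (Pi.single j 1)) /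
        inner ℂ (γ (star w)) (γ (star w)) := by
  simp only [ofReal_log_norm_sq]
  rw [wirtingerBar_comp (f := fun v => inner ℂ (γ (star v)) (γ (star v)))
    (Complex.hasDerivAt_log (inner_self_mem_slitPlane hne))
    (differentiableAt_inner_comp_star hγ hγ), wirtingerBar_inner_comp_star hγ hγ, inv_mul_eq_div]

theorem frameCurvature_apply [CompleteSpace E]
    (hγ : ∀ᶠ u in 𝓝 (star w), DifferentiableAt ℂ γ u) (hne : γ (star w) ≠ 0) (i j : Fin m) :
    frameCurvature γ w i j =
      -(innerWedge (γ (star w)) (fderiv ℂ γ (star w) (Pi.single i 1))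
          (fderiv ℂ γ (star w) (Pi.single j 1)) / inner ℂ (γ (star w)) (γ (star w)) ^ 2) := by
  have hγw : DifferentiableAt ℂ γ (star w) := hγ.self_of_nhds
  have hγ' := differentiableAt_fderiv_apply hγ (Pi.single j 1)
  have hbar : wirtingerBar j (fun v => ((Real.log (‖γ (star v)‖ ^ 2) : ℝ) : ℂ)) =ᶠ[𝓝 w]
      fun v => inner ℂ (γ (star v)) (fderiv ℂ γ (star v) (Pi.single j 1)) /
        inner ℂ (γ (star v)) (γ (star v)) := by
    filter_upwards [continuous_star.continuousAt.eventually
      (hγ.and (hγw.continuousAt.eventually_ne hne))] with v hv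
    exact wirtingerBar_log_norm_sq_comp_star hv.1 hv.2 j
  rw [frameCurvature, Matrix.of_apply, wirtinger_congr hbar,
    wirtinger_div (differentiableAt_inner_comp_star hγw hγ')
      (differentiableAt_inner_comp_star hγw hγw) (inner_self_ne_zero.mpr hne),
    wirtinger_inner_comp_star hγw hγ', wirtinger_inner_comp_star hγw hγw, innerWedge]

theorem frameCurvature_eq_of_eventuallyEq_smul [CompleteSpace E] {c : (Fin m → ℂ) → ℂ}
    (h₁ : ∀ᶠ u in 𝓝 (star w), DifferentiableAt ℂ γ₁ u)
    (h₂ : ∀ᶠ u in 𝓝 (star w), DifferentiableAt ℂ γ₂ u)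
    (hne : γ₂ (star w) ≠ 0) (hc : DifferentiableAt ℂ c (star w))
    (heq : γ₂ =ᶠ[𝓝 (star w)] fun u => c u • γ₁ u) :
    frameCurvature γ₁ w = frameCurvature γ₂ w := by
  have hval : γ₂ (star w) = c (star w) • γ₁ (star w) := heq.eq_of_nhds
  obtain ⟨hc₀, hne₁⟩ := smul_ne_zero_iff.mp (hval ▸ hne)
  have hderiv : ∀ x, fderiv ℂ γ₂ (star w) x =
      c (star w) • fderiv ℂ γ₁ (star w) x + fderiv ℂ c (star w) x • γ₁ (star w) := fun x => by
    rw [heq.fderiv_eq, fderiv_fun_smul hc h₁.self_of_nhds]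
    rfl
  have hscale : (conj (c (star w)) * c (star w)) ^ 2 ≠ 0 := by simpa using hc₀
  ext i j
  rw [frameCurvature_apply h₁ hne₁, frameCurvature_apply h₂ hne, hderiv, hderiv, hval,
    innerWedge_smul_smul_add_smul, inner_smul_left, inner_smul_right, ← mul_assoc,
    mul_pow _ (inner ℂ _ _), mul_div_mul_left _ _ hscale]

theorem exists_eventuallyEq_smul {X : Type*} [NormedAddCommGroup X] [NormedSpace ℂ X]
    {γ₁ γ₂ : X → E} {u₀ : X} (h₁ : DifferentiableAt ℂ γ₁ u₀) (h₂ : DifferentiableAt ℂ γ₂ u₀)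
    (hne : γ₁ u₀ ≠ 0) (hspan : ∀ᶠ u in 𝓝 u₀, γ₂ u ∈ Submodule.span ℂ {γ₁ u}) :
    ∃ c : X → ℂ, DifferentiableAt ℂ c u₀ ∧ γ₂ =ᶠ[𝓝 u₀] fun u => c u • γ₁ u := by
  set a := γ₁ u₀
  have hd₁ : DifferentiableAt ℂ (fun u => inner ℂ a (γ₁ u)) u₀ :=
    (innerSL ℂ a).differentiableAt.comp _ h₁
  have hd₂ : DifferentiableAt ℂ (fun u => inner ℂ a (γ₂ u)) u₀ :=
    (innerSL ℂ a).differentiableAt.comp _ h₂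
  have ha : inner ℂ a (γ₁ u₀) ≠ 0 := inner_self_ne_zero.mpr hne
  refine ⟨fun u => inner ℂ a (γ₂ u) * (inner ℂ a (γ₁ u))⁻¹, hd₂.fun_mul (hd₁.fun_inv ha), ?_⟩
  filter_upwards [hspan, hd₁.continuousAt.eventually_ne ha] with u hu hau
  obtain ⟨r, hr⟩ := Submodule.mem_span_singleton.mp hu
  rw [← hr, inner_smul_right, mul_inv_cancel_right₀ hau]

theorem IsHolomorphicFrame.eventually_differentiableAt {T : Fin m → E →L[ℂ] E}
    {U : Set (Fin m → ℂ)} (h : IsHolomorphicFrame T U γ) {u : Fin m → ℂ} (hu : u ∈ U) :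
    ∀ᶠ v in 𝓝 u, DifferentiableAt ℂ γ v :=
  h.differentiableOn.eventually_differentiableAt (h.isOpen.mem_nhds hu)

theorem IsHolomorphicFrame.frameCurvature_eq [CompleteSpace E] {T : Fin m → E →L[ℂ] E}
    {U₁ U₂ : Set (Fin m → ℂ)} (h₁ : IsHolomorphicFrame T U₁ γ₁)
    (h₂ : IsHolomorphicFrame T U₂ γ₂) (hw₁ : star w ∈ U₁) (hw₂ : star w ∈ U₂) :
    frameCurvature γ₁ w = frameCurvature γ₂ w := by
  have hd₁ := h₁.eventually_differentiableAt hw₁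
  have hd₂ := h₂.eventually_differentiableAt hw₂
  have hspan : ∀ᶠ u in 𝓝 (star w), γ₂ u ∈ Submodule.span ℂ {γ₁ u} := by
    filter_upwards [h₁.isOpen.mem_nhds hw₁, h₂.isOpen.mem_nhds hw₂] with u hu₁ hu₂
    rw [h₁.span_eq u hu₁, ← h₂.span_eq u hu₂]
    exact Submodule.mem_span_singleton_self _
  obtain ⟨c, hc, heq⟩ :=
    exists_eventuallyEq_smul hd₁.self_of_nhds hd₂.self_of_nhds (h₁.ne_zero _ hw₁) hspan
  exact frameCurvature_eq_of_eventuallyEq_smul hd₁ hd₂ (h₂.ne_zero _ hw₂) hc heq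

theorem frameCurvature_linearIsometryEquiv {H : Type*} [NormedAddCommGroup H]
    [InnerProductSpace ℂ H] (V : E ≃ₗᵢ[ℂ] H) (γ : (Fin m → ℂ) → E) (w : Fin m → ℂ) :
    frameCurvature (fun u => V (γ u)) w = frameCurvature γ w := by
  simp only [frameCurvature, V.norm_map]

end Curvature

section DiagonalKernel

open Submodule

/-- The bounded bilinear map `(f, g) ↦ f ⊗ g` into the Hilbert space tensor product. -/
noncomputable def tmulL (H G : Type*) [NormedAddCommGroup H] [InnerProductSpace ℂ H]
    [NormedAddCommGroup G] [InnerProductSpace ℂ G] : H →L[ℂ] G →L[ℂ] HilbertTensor H G :=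
  (ContinuousLinearMap.compL ℂ G (H ⊗[ℂ] G) (HilbertTensor H G)
    UniformSpace.Completion.toComplL).comp (TensorProduct.mkL ℂ H G)

theorem inner_tmulL {H G : Type*} [NormedAddCommGroup H] [InnerProductSpace ℂ H]
    [NormedAddCommGroup G] [InnerProductSpace ℂ G] (f f' : H) (g g' : G) :
    inner ℂ (tmulL H G f g) (tmulL H G f' g') = inner ℂ f f' * inner ℂ g g' := by
  simp [tmulL]

theorem scalarKernel_eq_inner {Y : Type*} (G : Type*) [NormedAddCommGroup G]
    [InnerProductSpace ℂ G] [CompleteSpace G] [RKHS ℂ G Y ℂ] (x y : Y) :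
    scalarKernel G x y = inner ℂ (RKHS.kerFun G x (1 : ℂ)) (RKHS.kerFun G y (1 : ℂ)) := by
  rw [RKHS.kerFun_inner, RKHS.kerFun_apply]
  simp [scalarKernel]

variable {X H : Type*} [NormedAddCommGroup H] [InnerProductSpace ℂ H] [CompleteSpace H]
  [RKHS ℂ H X ℂ]

theorem inner_tmulL_kerFun (f : HilbertTensor H H) (x y : X) :
    inner ℂ (tmulL H H (RKHS.kerFun H x (1 : ℂ)) (RKHS.kerFun H y (1 : ℂ))) f = f (x, y) := rfl

/-- The `𝒜₀`-component of `a ⊗ b`, as a linear function of `b`. -/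
noncomputable def projTmul (a : H) : H →L[ℂ] diagVanishing H :=
  (diagVanishing H).orthogonalProjectionOnto.comp (tmulL H H a)

theorem kerFun_diagVanishing (x y : X) :
    RKHS.kerFun (diagVanishing H) (x, y) (1 : ℂ) =
      projTmul (RKHS.kerFun H x (1 : ℂ)) (RKHS.kerFun H y (1 : ℂ)) := by
  refine ext_inner_right ℂ fun f => ?_
  rw [RKHS.kerFun_inner, projTmul, ContinuousLinearMap.comp_apply,
    inner_orthogonalProjectionOnto_eq_of_mem_right, inner_tmulL_kerFun]
  simp only [RCLike.inner_apply, map_one, mul_one]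
  rfl

theorem tmulL_kerFun_self_mem_orthogonal (x : X) :
    tmulL H H (RKHS.kerFun H x (1 : ℂ)) (RKHS.kerFun H x (1 : ℂ)) ∈ (diagVanishing H)ᗮ := by
  rw [mem_orthogonal']
  intro f hf
  rw [inner_tmulL_kerFun]
  exact hf x

theorem projTmul_kerFun_self (x : X) :
    projTmul (RKHS.kerFun H x (1 : ℂ)) (RKHS.kerFun H x (1 : ℂ)) = 0 := by
  rw [projTmul, ContinuousLinearMap.comp_apply,
    orthogonalProjectionOnto_apply_of_mem_orthogonal (tmulL_kerFun_self_mem_orthogonal x)]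

theorem tmulL_sub_tmulL_mem_diagVanishing (f g : H) :
    tmulL H H f g - tmulL H H g f ∈ diagVanishing H := fun x => by
  have heval : ∀ a b : H, tmulL H H a b (x, x) = a x * b x := fun a b =>
    tensorEval_tmul H H a b x x
  rw [RKHS.coe_sub, Pi.sub_apply, heval, heval, mul_comm, sub_self]

theorem coe_projTmul_of_mem_orthogonal {a b : H}
    (h : tmulL H H a b + tmulL H H b a ∈ (diagVanishing H)ᗮ) :
    (projTmul a b : HilbertTensor H H) = (2⁻¹ : ℂ) • (tmulL H H a b - tmulL H H b a) := by
  have hsplit : tmulL H H a b = (2⁻¹ : ℂ) • (tmulL H H a b - tmulL H H b a) +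
      (2⁻¹ : ℂ) • (tmulL H H a b + tmulL H H b a) := by module
  exact eq_starProjection_of_mem_orthogonal'
    (smul_mem _ _ (tmulL_sub_tmulL_mem_diagVanishing a b)) (smul_mem _ _ h) hsplit

theorem inner_projTmul_of_mem_orthogonal {a b c : H}
    (hb : tmulL H H a b + tmulL H H b a ∈ (diagVanishing H)ᗮ)
    (hc : tmulL H H a c + tmulL H H c a ∈ (diagVanishing H)ᗮ) :
    inner ℂ (projTmul a b : HilbertTensor H H) (projTmul a c) = innerWedge a b c / 2 := by
  rw [coe_projTmul_of_mem_orthogonal hb, coe_projTmul_of_mem_orthogonal hc]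
  simp only [innerWedge, inner_smul_left, inner_smul_right, inner_sub_left, inner_sub_right,
    inner_tmulL, map_inv₀, map_ofNat]
  ring

end DiagonalKernel

theorem apply_mem_of_hasFDerivAt_of_eventually_mem {𝕜 X Y : Type*} [NontriviallyNormedField 𝕜]
    [NormedAddCommGroup X] [NormedSpace 𝕜 X] [NormedAddCommGroup Y] [NormedSpace 𝕜 Y]
    {K : Submodule 𝕜 Y} (hK : IsClosed (K : Set Y)) {F : X → Y} {F' : X →L[𝕜] Y} {x : X}
    (hF : HasFDerivAt F F' x) (hmem : ∀ᶠ u in 𝓝 x, F u ∈ K) (v : X) : F' v ∈ K := by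
  refine hK.mem_of_tendsto (hF.hasLineDerivAt v).tendsto_slope_zero ?_
  have hline : Tendsto (fun t : 𝕜 => x + t • v) (𝓝 0) (𝓝 x) := by
    have hcont : Continuous fun t : 𝕜 => x + t • v := by fun_prop
    simpa using hcont.tendsto 0
  filter_upwards [nhdsWithin_le_nhds (hline.eventually hmem)] with t ht
  exact K.smul_mem _ (K.sub_mem ht hmem.self_of_nhds)

section KernelSection

variable {m : ℕ} {Ω₀ : Set (Fin m → ℂ)} {H : Type*} [NormedAddCommGroup H]
  [InnerProductSpace ℂ H] [RKHS ℂ H Ω₀ ℂ] [CompleteSpace H]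

/-- The section `u ↦ K(·, ū)` of kernel functions over `Ω₀^*`, extended by zero to all of `ℂ^m` so
that it can be differentiated. -/
noncomputable def kernelSection (Ω₀ : Set (Fin m → ℂ)) (H : Type*) [NormedAddCommGroup H]
    [InnerProductSpace ℂ H] [RKHS ℂ H Ω₀ ℂ] [CompleteSpace H] (u : Fin m → ℂ) : H :=
  Function.extend Subtype.val (fun x : Ω₀ => RKHS.kerFun H x (1 : ℂ)) 0 (star u)

/-- The derivative `∂̄_i K(·, z)` of the kernel function in its second argument. -/
noncomputable def kernelBarDeriv (H : Type*) [NormedAddCommGroup H] [InnerProductSpace ℂ H]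
    [RKHS ℂ H Ω₀ ℂ] [CompleteSpace H] (z : Ω₀) (i : Fin m) : H :=
  fderiv ℂ (kernelSection Ω₀ H) (star z.1) (Pi.single i 1)

/-- The points of `Ω₀`, other than `z`, that differ from `z` in the `i`-th coordinate only. -/
def puncturedCoordLine (z : Ω₀) (i : Fin m) : Set Ω₀ :=
  {ζ | ζ.1 i ≠ z.1 i ∧ ∀ l, l ≠ i → ζ.1 l = z.1 l}

theorem kernelSection_star (x : Ω₀) :
    kernelSection Ω₀ H (star x.1) = RKHS.kerFun H x (1 : ℂ) := by
  rw [kernelSection, star_star]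
  exact Subtype.val_injective.extend_apply _ _ x

theorem kernelSection_of_mem {u : Fin m → ℂ} (hu : u ∈ conjSet Ω₀) :
    kernelSection Ω₀ H u = RKHS.kerFun H (⟨star u, hu⟩ : Ω₀) (1 : ℂ) :=
  Subtype.val_injective.extend_apply _ _ (⟨star u, hu⟩ : Ω₀)

theorem isOpen_conjSet (hΩ₀ : IsOpen Ω₀) : IsOpen (conjSet Ω₀) :=
  hΩ₀.preimage continuous_star

theorem differentiableOn_innerSL_kernelSection_star (hΩ₀ : IsOpen Ω₀)
    (hol : ConsistsOfHolomorphic Ω₀ H) :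
    DifferentiableOn ℂ (fun x => innerSL ℂ (kernelSection Ω₀ H (star x))) Ω₀ :=
  differentiableOn_clm_of_apply hΩ₀ fun f => (hol f).congr fun x hx => by
    rw [innerSL_apply_apply, kernelSection_star (⟨x, hx⟩ : Ω₀), RKHS.kerFun_inner,
      Subtype.val_injective.extend_apply (f : Ω₀ → ℂ) 0 (⟨x, hx⟩ : Ω₀)]
    simp

theorem differentiableOn_kernelSection (hΩ₀ : IsOpen Ω₀) (hol : ConsistsOfHolomorphic Ω₀ H) :
    DifferentiableOn ℂ (kernelSection Ω₀ H) (conjSet Ω₀) := fun u hu => by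
  have hdual : DifferentiableAt ℂ (fun x => innerSL ℂ (kernelSection Ω₀ H (star x)))
      ((starL ℂ : (Fin m → ℂ) ≃L⋆[ℂ] (Fin m → ℂ)).toContinuousLinearMap u) :=
    (differentiableOn_innerSL_kernelSection_star hΩ₀ hol).differentiableAt (hΩ₀.mem_nhds hu)
  have hriesz := hdual.comp_semilinear₂
    ((InnerProductSpace.toDual ℂ H).symm.toContinuousLinearEquiv : (H →L[ℂ] ℂ) →L⋆[ℂ] H)
  refine (hriesz.congr_of_eventuallyEq (.of_eq (funext fun v => ?_))).differentiableWithinAt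
  refine ext_inner_right ℂ fun f => ?_
  simp

theorem eventually_differentiableAt_kernelSection (hΩ₀ : IsOpen Ω₀)
    (hol : ConsistsOfHolomorphic Ω₀ H) (z : Ω₀) :
    ∀ᶠ u in 𝓝 (star z.1), DifferentiableAt ℂ (kernelSection Ω₀ H) u :=
  (differentiableOn_kernelSection hΩ₀ hol).eventually_differentiableAt
    ((isOpen_conjSet hΩ₀).mem_nhds (by simp [conjSet]))

theorem tmulL_add_tmulL_kernelBarDeriv_mem_orthogonal (hΩ₀ : IsOpen Ω₀)
    (hol : ConsistsOfHolomorphic Ω₀ H) (z : Ω₀) (i : Fin m) :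
    tmulL H H (RKHS.kerFun H z (1 : ℂ)) (kernelBarDeriv H z i) +
      tmulL H H (kernelBarDeriv H z i) (RKHS.kerFun H z (1 : ℂ)) ∈ (diagVanishing H)ᗮ := by
  have hderiv := (eventually_differentiableAt_kernelSection hΩ₀ hol z).self_of_nhds.hasFDerivAt
  have hmem : ∀ᶠ u in 𝓝 (star z.1),
      tmulL H H (kernelSection Ω₀ H u) (kernelSection Ω₀ H u) ∈ (diagVanishing H)ᗮ := by
    filter_upwards [(isOpen_conjSet hΩ₀).mem_nhds (by simp [conjSet])] with u hu
    rw [kernelSection_of_mem hu]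
    exact tmulL_kerFun_self_mem_orthogonal _
  have h := apply_mem_of_hasFDerivAt_of_eventually_mem (diagVanishing H).isClosed_orthogonal
    ((tmulL H H).hasFDerivAt_of_bilinear hderiv hderiv) hmem (Pi.single i 1)
  simpa [kernelSection_star, kernelBarDeriv] using h

theorem tendsto_slope_kerFun (hΩ₀ : IsOpen Ω₀) (hol : ConsistsOfHolomorphic Ω₀ H)
    (z : Ω₀) (i : Fin m) :
    Tendsto (fun ζ : Ω₀ => (conj (ζ.1 i) - conj (z.1 i))⁻¹ •
        (RKHS.kerFun H ζ (1 : ℂ) - RKHS.kerFun H z (1 : ℂ)))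
      (𝓝[puncturedCoordLine z i] z) (𝓝 (kernelBarDeriv H z i)) := by
  have hderiv := (eventually_differentiableAt_kernelSection hΩ₀ hol z).self_of_nhds.hasFDerivAt
  have hparam : Tendsto (fun ζ : Ω₀ => conj (ζ.1 i) - conj (z.1 i))
      (𝓝[puncturedCoordLine z i] z) (𝓝[≠] 0) := by
    have hcont : Continuous fun ζ : Ω₀ => conj (ζ.1 i) - conj (z.1 i) :=
      (Complex.continuous_conj.comp ((continuous_apply i).comp continuous_subtype_val)).sub
        continuous_const
    refine tendsto_nhdsWithin_iff.mpr
      ⟨by simpa using (hcont.tendsto z).mono_left nhdsWithin_le_nhds, ?_⟩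
    filter_upwards [self_mem_nhdsWithin] with ζ hζ
    exact sub_ne_zero.mpr ((starRingEnd ℂ).injective.ne hζ.1)
  refine ((hderiv.hasLineDerivAt (Pi.single i 1)).tendsto_slope_zero.comp hparam).congr' ?_
  filter_upwards [self_mem_nhdsWithin] with ζ hζ
  have hline : star z.1 + (conj (ζ.1 i) - conj (z.1 i)) • Pi.single i (1 : ℂ) = star ζ.1 := by
    ext l
    obtain rfl | hl := eq_or_ne l i
    · simp
    · simp [hl, hζ.2 l hl]
  rw [Function.comp_apply, hline, kernelSection_star, kernelSection_star]

theorem scalarKernel_diagVanishing_div (z ζ ν : Ω₀) (s t : ℂ) :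
    scalarKernel (diagVanishing H) (z, ζ) (z, ν) / (conj s * t) =
      inner ℂ (projTmul (RKHS.kerFun H z (1 : ℂ))
          (s⁻¹ • (RKHS.kerFun H ζ (1 : ℂ) - RKHS.kerFun H z (1 : ℂ))) : HilbertTensor H H)
        (projTmul (RKHS.kerFun H z (1 : ℂ))
          (t⁻¹ • (RKHS.kerFun H ν (1 : ℂ) - RKHS.kerFun H z (1 : ℂ)))) := by
  simp only [map_smul, map_sub, projTmul_kerFun_self, sub_zero, Submodule.coe_smul]
  rw [scalarKernel_eq_inner, kerFun_diagVanishing, kerFun_diagVanishing, Submodule.coe_inner,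
    inner_smul_left, inner_smul_right, map_inv₀, div_eq_mul_inv, mul_inv]
  ring

theorem tendsto_scalarKernel_diagVanishing_div (hΩ₀ : IsOpen Ω₀)
    (hol : ConsistsOfHolomorphic Ω₀ H) (z : Ω₀) (i j : Fin m) :
    Tendsto
      (fun p : Ω₀ × Ω₀ => scalarKernel (diagVanishing H) (z, p.1) (z, p.2) /
        ((z.1 i - p.1.1 i) * (conj (z.1 j) - conj (p.2.1 j))))
      (𝓝[puncturedCoordLine z i] z ×ˢ 𝓝[puncturedCoordLine z j] z)
      (𝓝 (innerWedge (RKHS.kerFun H z (1 : ℂ)) (kernelBarDeriv H z i) (kernelBarDeriv H z j) /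
        2)) := by
  have hslope := fun l =>
    ((continuous_subtype_val.comp (projTmul (RKHS.kerFun H z (1 : ℂ))).continuous).tendsto _).comp
      (tendsto_slope_kerFun hΩ₀ hol z l)
  have horth := tmulL_add_tmulL_kernelBarDeriv_mem_orthogonal hΩ₀ hol z
  rw [← inner_projTmul_of_mem_orthogonal (horth i) (horth j)]
  refine (((hslope i).comp tendsto_fst).inner ((hslope j).comp tendsto_snd)).congr fun p => ?_
  simp only [Function.comp_apply]
  rw [← scalarKernel_diagVanishing_div, map_sub, Complex.conj_conj, Complex.conj_conj,
    ← neg_mul_neg, neg_sub, neg_sub]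

theorem frameCurvature_kernelSection (hΩ₀ : IsOpen Ω₀) (hol : ConsistsOfHolomorphic Ω₀ H)
    (z : Ω₀) (hz : RKHS.kerFun H z (1 : ℂ) ≠ 0) (i j : Fin m) :
    frameCurvature (kernelSection Ω₀ H) z i j =
      -(innerWedge (RKHS.kerFun H z (1 : ℂ)) (kernelBarDeriv H z i) (kernelBarDeriv H z j) /
        scalarKernel H z z ^ 2) := by
  rw [frameCurvature_apply (eventually_differentiableAt_kernelSection hΩ₀ hol z)
    (by rwa [kernelSection_star]), kernelSection_star, scalarKernel_eq_inner]
  rfl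

end KernelSection

section KernelBundle

variable {m : ℕ} {E : Type*} [NormedAddCommGroup E] [InnerProductSpace ℂ E]
  {Ω₀ : Set (Fin m → ℂ)} {H : Type*} [NormedAddCommGroup H] [InnerProductSpace ℂ H]
  [CompleteSpace H] [RKHS ℂ H Ω₀ ℂ]

theorem mem_jointKer_iff {T : Fin m → E →L[ℂ] E} {w : Fin m → ℂ} {x : E} :
    x ∈ jointKer T w ↔ ∀ i, T i x = w i • x := by
  simp [jointKer, tupleSub, funext_iff, sub_eq_zero]

theorem adjoint_apply_kerFun {M : Fin m → H →L[ℂ] H} (hM : IsCoordinateMultiplication M)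
    (x : Ω₀) (i : Fin m) :
    ContinuousLinearMap.adjoint (M i) (RKHS.kerFun H x (1 : ℂ)) =
      conj (x.1 i) • RKHS.kerFun H x (1 : ℂ) := by
  refine ext_inner_right ℂ fun f => ?_
  rw [ContinuousLinearMap.adjoint_inner_left, inner_smul_left, RKHS.kerFun_inner,
    RKHS.kerFun_inner, hM i f x]
  simp

theorem symm_kerFun_mem_jointKer {T : Fin m → E →L[ℂ] E} {M : Fin m → H →L[ℂ] H}
    (hM : IsCoordinateMultiplication M) (V : E ≃ₗᵢ[ℂ] H)
    (hV : ∀ i x, V (T i x) = ContinuousLinearMap.adjoint (M i) (V x)) (x : Ω₀) :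
    V.symm (RKHS.kerFun H x (1 : ℂ)) ∈ jointKer T (star x.1) := by
  refine mem_jointKer_iff.mpr fun i => V.injective ?_
  rw [hV, map_smul, V.apply_symm_apply, adjoint_apply_kerFun hM]
  rfl

theorem isHolomorphicFrame_kernelSection {T : Fin m → E →L[ℂ] E}
    (hT : ∀ w ∈ conjSet Ω₀, Module.rank ℂ (jointKer T w) = 1) (hΩ₀ : IsOpen Ω₀)
    (hol : ConsistsOfHolomorphic Ω₀ H) {M : Fin m → H →L[ℂ] H}
    (hM : IsCoordinateMultiplication M) (V : E ≃ₗᵢ[ℂ] H)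
    (hV : ∀ i x, V (T i x) = ContinuousLinearMap.adjoint (M i) (V x)) :
    IsHolomorphicFrame T (conjSet Ω₀ ∩ kernelSection Ω₀ H ⁻¹' {0}ᶜ)
      (fun u => V.symm (kernelSection Ω₀ H u)) where
  isOpen := (differentiableOn_kernelSection hΩ₀ hol).continuousOn.isOpen_inter_preimage
    (isOpen_conjSet hΩ₀) isOpen_compl_singleton
  differentiableOn := V.symm.toContinuousLinearEquiv.differentiable.comp_differentiableOn
    ((differentiableOn_kernelSection hΩ₀ hol).mono Set.inter_subset_left)
  ne_zero u hu := by simpa using hu.2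
  span_eq u hu := by
    have hmem : V.symm (kernelSection Ω₀ H u) ∈ jointKer T u := by
      simpa [kernelSection_of_mem hu.1] using
        symm_kerFun_mem_jointKer hM V hV (⟨star u, hu.1⟩ : Ω₀)
    exact (eq_span_singleton_of_mem_of_finrank_eq_one
      (Module.rank_eq_one_iff_finrank_eq_one.mp (hT u hu.1)) hmem (by simpa using hu.2)).symm

theorem isCurvatureAt_frameCurvature_kernelSection {Ω : Set (Fin m → ℂ)}
    {T : Fin m → E →L[ℂ] E} (hT : ∀ w ∈ conjSet Ω₀, Module.rank ℂ (jointKer T w) = 1)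
    (hΩ₀o : IsOpen Ω₀) (hΩ₀ : Ω₀ ⊆ Ω) (hol : ConsistsOfHolomorphic Ω₀ H)
    {M : Fin m → H →L[ℂ] H} (hM : IsCoordinateMultiplication M) (V : E ≃ₗᵢ[ℂ] H)
    (hV : ∀ i x, V (T i x) = ContinuousLinearMap.adjoint (M i) (V x))
    (z : Ω₀) (hz : RKHS.kerFun H z (1 : ℂ) ≠ 0) :
    IsCurvatureAt Ω T z (frameCurvature (kernelSection Ω₀ H) z) := by
  have : CompleteSpace E := V.toIsometryEquiv.completeSpace
  have hframe := isHolomorphicFrame_kernelSection hT hΩ₀o hol hM V hV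
  have hzU : star z.1 ∈ conjSet Ω₀ ∩ kernelSection Ω₀ H ⁻¹' {0}ᶜ :=
    ⟨by simp [conjSet], by simpa [kernelSection_star] using hz⟩
  refine ⟨⟨_, _, fun u hu => hΩ₀ hu.1, hzU, hframe⟩, fun U γ _ hU hγ => ?_⟩
  rw [← frameCurvature_linearIsometryEquiv V.symm]
  exact hframe.frameCurvature_eq hγ hzU hU

end KernelBundle

end CowenDouglasCurvature

theorem mainTheorem8_general {m : ℕ} (Ω : Set (Fin m → ℂ))
    {E : Type*} [NormedAddCommGroup E] [InnerProductSpace ℂ E]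
    (T : Fin m → E →L[ℂ] E) (Ω₀ : Set (Fin m → ℂ))
    (hT : ∀ w ∈ conjSet Ω₀, Module.rank ℂ (jointKer T w) = 1)
    (hΩ₀o : IsOpen Ω₀) (hΩ₀ : Ω₀ ⊆ Ω)
    {H : Type*} [NormedAddCommGroup H] [InnerProductSpace ℂ H] [CompleteSpace H]
    [RKHS ℂ H Ω₀ ℂ] (hol : ConsistsOfHolomorphic Ω₀ H)
    (M : Fin m → H →L[ℂ] H) (hM : IsCoordinateMultiplication M)
    (V : E ≃ₗᵢ[ℂ] H) (hV : ∀ i x, V (T i x) = ContinuousLinearMap.adjoint (M i) (V x))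
    (z : Ω₀) (hz : scalarKernel H z z ≠ 0) :
    ∃ 𝒦 : Matrix (Fin m) (Fin m) ℂ, IsCurvatureAt Ω T z 𝒦 ∧
      (∀ i j : Fin m, ∃ L : ℂ,
        Tendsto
          (fun p : Ω₀ × Ω₀ =>
            scalarKernel (diagVanishing H) (z, p.1) (z, p.2) /
              ((z.1 i - p.1.1 i) * (conj (z.1 j) - conj (p.2.1 j))))
          (𝓝[puncturedCoordLine z i ×ˢ puncturedCoordLine z j] (z, z)) (𝓝 L) ∧
        𝒦 i j = -(2 / scalarKernel H z z ^ 2) * L) ∧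
      (∀ i : Fin m, ∃ L : ℂ,
        Tendsto
          (fun ζ : Ω₀ =>
            scalarKernel (diagVanishing H) (z, ζ) (z, ζ) /
              ((z.1 i - ζ.1 i) * (conj (z.1 i) - conj (ζ.1 i))))
          (𝓝[puncturedCoordLine z i] z) (𝓝 L) ∧
        𝒦 i i = -(2 / scalarKernel H z z ^ 2) * L) := by
  have hkz : RKHS.kerFun H z (1 : ℂ) ≠ 0 := fun h => hz (by simp [scalarKernel_eq_inner, h])
  have hlim := tendsto_scalarKernel_diagVanishing_div hΩ₀o hol z
  have hcurv : ∀ i j, frameCurvature (kernelSection Ω₀ H) z i j =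
      -(2 / scalarKernel H z z ^ 2) * (innerWedge (RKHS.kerFun H z (1 : ℂ))
        (kernelBarDeriv H z i) (kernelBarDeriv H z j) / 2) := fun i j => by
    rw [frameCurvature_kernelSection hΩ₀o hol z hkz]
    ring
  refine ⟨frameCurvature (kernelSection Ω₀ H) z,
    isCurvatureAt_frameCurvature_kernelSection hT hΩ₀o hΩ₀ hol hM V hV z hkz,
    fun i j => ⟨_, ?_, hcurv i j⟩, fun i => ⟨_, ?_, hcurv i i⟩⟩
  · rw [nhdsWithin_prod_eq]
    exact hlim i j
  · have hdiag : Tendsto (fun ζ : Ω₀ => (ζ, ζ)) (𝓝[puncturedCoordLine z i] z)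
        (𝓝[puncturedCoordLine z i] z ×ˢ 𝓝[puncturedCoordLine z i] z) :=
      tendsto_id.prodMk tendsto_id
    simpa only [Function.comp_def] using (hlim i i).comp hdiag

theorem mainTheorem8 {m : ℕ}
    (Ω : Set (Fin m → ℂ)) (hΩo : IsOpen Ω) (hΩc : IsConnected Ω) (hΩb : Bornology.IsBounded Ω)
    {E : Type*} [NormedAddCommGroup E] [InnerProductSpace ℂ E] [CompleteSpace E]
    [TopologicalSpace.SeparableSpace E]
    (T : Fin m → E →L[ℂ] E) (hT : IsCowenDouglas 1 (conjSet Ω) T)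
    (Ω₀ : Set (Fin m → ℂ)) (hΩ₀o : IsOpen Ω₀) (hΩ₀ : Ω₀ ⊆ Ω)
    {H : Type*} [NormedAddCommGroup H] [InnerProductSpace ℂ H] [CompleteSpace H]
    [RKHS ℂ H Ω₀ ℂ] (hol : ConsistsOfHolomorphic Ω₀ H)
    (M : Fin m → H →L[ℂ] H) (hM : IsCoordinateMultiplication M)
    (V : E ≃ₗᵢ[ℂ] H) (hV : ∀ i x, V (T i x) = ContinuousLinearMap.adjoint (M i) (V x))
    (z : Ω₀) (hz : scalarKernel H z z ≠ 0) :
    ∃ 𝒦 : Matrix (Fin m) (Fin m) ℂ, IsCurvatureAt Ω T z 𝒦 ∧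
      (∀ i j : Fin m, ∃ L : ℂ,
        Tendsto
          (fun p : Ω₀ × Ω₀ =>
            scalarKernel (diagVanishing H) (z, p.1) (z, p.2) /
              ((z.1 i - p.1.1 i) * (conj (z.1 j) - conj (p.2.1 j))))
          (𝓝[{p : Ω₀ × Ω₀ | (p.1.1 i ≠ z.1 i ∧ ∀ l, l ≠ i → p.1.1 l = z.1 l) ∧
              (p.2.1 j ≠ z.1 j ∧ ∀ l, l ≠ j → p.2.1 l = z.1 l)}] (z, z))
          (𝓝 L) ∧
        𝒦 i j = -(2 / scalarKernel H z z ^ 2) * L) ∧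
      (∀ i : Fin m, ∃ L : ℂ,
        Tendsto
          (fun ζ : Ω₀ =>
            scalarKernel (diagVanishing H) (z, ζ) (z, ζ) /
              ((z.1 i - ζ.1 i) * (conj (z.1 i) - conj (ζ.1 i))))
          (𝓝[{ζ : Ω₀ | ζ.1 i ≠ z.1 i ∧ ∀ l, l ≠ i → ζ.1 l = z.1 l}] z)
          (𝓝 L) ∧
        𝒦 i i = -(2 / scalarKernel H z z ^ 2) * L) :=
  mainTheorem8_general Ω T Ω₀ (fun w hw => by simpa using hT.rank_ker w (hΩ₀ hw)) hΩ₀o hΩ₀ hol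
    M hM V hV z hz
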